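/- Let $t_1<t_2$ and let $A,C,\Sigma:[t_1,t_2]\to\mathbb R^{n\times n}$ be bounded and continuous except at finitely many points, with $C(t)$ and $\Sigma(t)$ symmetric. A solution of a matrix differential equation on $[t_1,t_2]$ is a continuous function satisfying the equation at all but finitely many times (one-sidedly at the end points). A prime on a matrix or vector denotes transposition. Let $p_t$ on $[t_1,t_2]$ solve the Riccati equation $$-\dot p_t=A(t)'p_t+p_tA(t)+C(t)+p_t\Sigma(t)p_t,$$ with $p_{t_2}$ symmetric, and let $(P_t,S_t,Q_t)$ on $[t_1,t_2]$ solve $$-\dot P_t=A(t)'P_t+P_tA(t)+C(t)+P_t\Sigma(t)P_t,\qquad -\dot S_t=(A(t)+\Sigma(t)P_t)'S_t,\qquad -\dot Q_t=S_t'\Sigma(t)S_t,$$ with $P_{t_2},Q_{t_2}$ symmetric and $S_{t_2}$ invertible. Put $$\mathcal P_t(x)=\tfrac12x'p_tx,\qquad \phi_t(x,z)=\tfrac12x'P_tx+x'S_tz+\tfrac12z'Q_tz .$$ Assume: (A.2) $p_{t_2}\succeq P_{t_2}$, and for every $t\in[t_1,t_2]$ the semiconvex dual of $\mathcal P_t$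 under the kernel $\phi_{t_2}$, $$\mathcal Q_t(z)=\inf_{x\in\mathbb R^n}\left[\mathcal P_t(x)-\phi_{t_2}(x,z)\right],$$ is a finite quadratic function $\mathcal Q_t(z)=\tfrac12z'q_tz$, with $q_t$ symmetric; (A.3) $A(t)'P_t+P_tA(t)+C(t)+P_t\Sigma(t)P_t\succ0$ for all $t\in[t_1,t_2]$. Then $P_{t_1}-P_{t_2}\succ0$, and with the dual kernel $$B(z,y)=\inf_{x\in\mathbb R^n}\left\{\phi_{t_1}(x,y)-\phi_{t_2}(x,z)\right\}$$ the function $\mathcal Q_{t_1}$ is the semiconvex primal of $\mathcal Q_{t_2}$ under $B$: $$\mathcal Q_{t_1}(z)=\sup_{y\in\mathbb R^n}\left[B(z,y)+\mathcal Q_{t_2}(y)\right]\qquad\text{for all }z\in\mathbb R^n .$$ Moreover $B(z,y)=\tfrac12z'B_{11}z+z'B_{12}y+\tfrac12y'B_{22}y$ for all $z,y\in\mathbb R^n$, where $$B_{11}=-S_{t_2}'(P_{t_1}-P_{t_2})^{-1}S_{t_2}-Q_{t_2},\qquad B_{12}=S_{t_2}'(P_{t_1}-P_{t_2})^{-1}S_{t_1},\qquad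 B_{22}=-S_{t_1}'(P_{t_1}-P_{t_2})^{-1}S_{t_1}+Q_{t_1},$$ the matrix $B_{22}+q_{t_2}$ is invertible, and $$q_{t_1}=B_{11}-B_{12}\left(B_{22}+q_{t_2}\right)^{-1}B_{12}'.$$ -/

import Mathlib

open Set Matrix

/-- Regularity of a coefficient matrix of the Riccati equation on `[t₁, t₂]`:
piecewise continuous (finitely many discontinuities) and bounded. -/
structure IsPiecewiseCoeff {n : ℕ} (t₁ t₂ : ℝ) (M : ℝ → Matrix (Fin n) (Fin n) ℝ) : Prop where
  finite_discont : {t ∈ Icc t₁ t₂ | ¬ ContinuousWithinAt M (Icc t₁ t₂) t}.Finite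
  bounded : ∃ K : ℝ, ∀ t ∈ Icc t₁ t₂, ∀ i j, |M t i j| ≤ K

/-- `X` solves the matrix equation `-dX/dt = F t (X t)` on `[t₁, t₂]`: it is continuous there, and
satisfies the equation (one-sidedly at the end points) outside a finite set of times. The
exceptional times account for the jumps of the coefficients. -/
def SolvesBackward {n : ℕ} (t₁ t₂ : ℝ)
    (F : ℝ → Matrix (Fin n) (Fin n) ℝ → Matrix (Fin n) (Fin n) ℝ)
    (X : ℝ → Matrix (Fin n) (Fin n) ℝ) : Prop :=
  ContinuousOn X (Icc t₁ t₂) ∧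
    ∃ D : Set ℝ, D.Finite ∧ ∀ t ∈ Icc t₁ t₂ \ D,
      HasDerivWithinAt X (-(F t (X t))) (Icc t₁ t₂) t

/-- The right-hand side `A(t)' p + p A(t) + C(t) + p Σ(t) p` of the Riccati equation. -/
def riccatiRHS {n : ℕ} (A C Sig : ℝ → Matrix (Fin n) (Fin n) ℝ) (t : ℝ)
    (p : Matrix (Fin n) (Fin n) ℝ) : Matrix (Fin n) (Fin n) ℝ :=
  (A t)ᵀ * p + p * A t + C t + p * Sig t * p

/-- The differential equations for the parameters `(P, S, Q)` of the bivariate quadratic: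
`-P' = A'P + PA + C + PΣP`, `-S' = (A + ΣP)'S`, `-Q' = S'ΣS`. -/
structure SolvesBivariateRiccati {n : ℕ} (t₁ t₂ : ℝ) (A C Sig : ℝ → Matrix (Fin n) (Fin n) ℝ)
    (P S Q : ℝ → Matrix (Fin n) (Fin n) ℝ) : Prop where
  eqP : SolvesBackward t₁ t₂ (riccatiRHS A C Sig) P
  eqS : SolvesBackward t₁ t₂ (fun t X => (A t + Sig t * P t)ᵀ * X) S
  eqQ : SolvesBackward t₁ t₂ (fun t _ => (S t)ᵀ * Sig t * S t) Q

/-- The quadratic function `x ↦ ½ x'px`. -/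
noncomputable def quadFun {n : ℕ} (p : Matrix (Fin n) (Fin n) ℝ) (x : Fin n → ℝ) : ℝ :=
  (1 / 2) * (x ⬝ᵥ p *ᵥ x)

/-- The bivariate quadratic `½ x'Px + x'Sz + ½ z'Qz`. -/
noncomputable def biquadFun {n : ℕ} (P S Q : Matrix (Fin n) (Fin n) ℝ) (x z : Fin n → ℝ) : ℝ :=
  (1 / 2) * (x ⬝ᵥ P *ᵥ x) + x ⬝ᵥ S *ᵥ z + (1 / 2) * (z ⬝ᵥ Q *ᵥ z)

/-- The semiconvex dual `z ↦ inf_x [f(x) - φ(x, z)]` of `f` under the kernel `φ`. -/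
noncomputable def semiconvexDual {n : ℕ} (φ : (Fin n → ℝ) → (Fin n → ℝ) → EReal)
    (f : (Fin n → ℝ) → EReal) (z : Fin n → ℝ) : EReal :=
  ⨅ x, (f x - φ x z)

/-- The semiconvex primal `x ↦ sup_z [φ(x, z) + g(z)]` of `g` under the kernel `φ`. -/
noncomputable def semiconvexPrimal {n : ℕ} (φ : (Fin n → ℝ) → (Fin n → ℝ) → EReal)
    (g : (Fin n → ℝ) → EReal) (x : Fin n → ℝ) : EReal :=
  ⨆ z, (φ x z + g z)

/-- The dual kernel `(z, y) ↦ inf_x [φ₁(x, y) - φ₂(x, z)]` of two kernels. -/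
noncomputable def dualKernel {n : ℕ} (φ₁ φ₂ : (Fin n → ℝ) → (Fin n → ℝ) → EReal)
    (z y : Fin n → ℝ) : EReal :=
  ⨅ x, (φ₁ x y - φ₂ x z)

/-- The quadratic `½ x'p_t x` of a matrix function `p` at time `t`. -/
noncomputable def primalAt {n : ℕ} (p : ℝ → Matrix (Fin n) (Fin n) ℝ) (t : ℝ)
    (x : Fin n → ℝ) : EReal :=
  ((quadFun (p t) x : ℝ) : EReal)

/-- The bivariate quadratic `φ_t(x, z)` with parameters `(P_t, S_t, Q_t)`. -/
noncomputable def kernelAt {n : ℕ} (P S Q : ℝ → Matrix (Fin n) (Fin n) ℝ) (t : ℝ)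
    (x z : Fin n → ℝ) : EReal :=
  ((biquadFun (P t) (S t) (Q t) x z : ℝ) : EReal)

/-- The semiconvex dual at time `t`: the dual of `½ x'p_t x` under the fixed kernel `φ_{t₂}`. -/
noncomputable def dualAt {n : ℕ} (P S Q p : ℝ → Matrix (Fin n) (Fin n) ℝ) (t₂ t : ℝ) :
    (Fin n → ℝ) → EReal :=
  semiconvexDual (kernelAt P S Q t₂) (primalAt p t)

/-- The matrix `B₁₁ = -S₂'(P₁ - P₂)⁻¹S₂ - Q₂`. -/
noncomputable def dualB11 {n : ℕ} (P₁ P₂ S₂ Q₂ : Matrix (Fin n) (Fin n) ℝ) :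
    Matrix (Fin n) (Fin n) ℝ :=
  -(S₂ᵀ * (P₁ - P₂)⁻¹ * S₂) - Q₂

/-- The matrix `B₁₂ = S₂'(P₁ - P₂)⁻¹S₁`. -/
noncomputable def dualB12 {n : ℕ} (P₁ P₂ S₁ S₂ : Matrix (Fin n) (Fin n) ℝ) :
    Matrix (Fin n) (Fin n) ℝ :=
  S₂ᵀ * (P₁ - P₂)⁻¹ * S₁

/-- The matrix `B₂₂ = -S₁'(P₁ - P₂)⁻¹S₁ + Q₁`. The sign of `Q₁` is the one forced by
`inf_x [φ₁(x, y) - φ₂(x, z)]`, whose value at `z = 0` contains the term `+½ y'Q₁y`. -/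
noncomputable def dualB22 {n : ℕ} (P₁ P₂ S₁ Q₁ : Matrix (Fin n) (Fin n) ℝ) :
    Matrix (Fin n) (Fin n) ℝ :=
  -(S₁ᵀ * (P₁ - P₂)⁻¹ * S₁) + Q₁

/-! Everything reduces to matrix algebra once `p_{t₁} - P_{t₂}` is written as a sum of two explicit
pieces. Write `E = P_{t₁} - P_{t₂}`. Integrating (A.3) gives `E ≻ 0`. Since `S_{t₂}` is invertible,
finiteness of the dual at every `z` bounds `½ x'(p_t - P_{t₂})x` below under every linear
perturbation, so `p_t - P_{t₂} ≻ 0`; completing the square then yields `q_t = -S_{t₂}'(p_t -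
P_{t₂})⁻¹S_{t₂} - Q_{t₂}`.

The analytic core is `riccati_sub_eq`: `p_t - P_t = S_t W_t⁻¹ S_t'` with `W_t = S_{t₂}'(p_{t₂} -
P_{t₂})⁻¹S_{t₂} + Q_{t₂} - Q_t ≻ 0`. With `Y = S⁻¹(p - P)S⁻ᵀ`, the equations give `Y' = -Y(S'ΣS)Y`
and `W' = S'ΣS`, so `YW - 1` solves a homogeneous linear equation and vanishes at `t₂`. Hence `W` is
invertible throughout and, being positive definite at `t₂`, never loses definiteness.

At `t₁` this reads `p_{t₁} - P_{t₂} = E + S_{t₁}W⁻¹S_{t₁}'`, while `B₂₂ + q_{t₂} =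
-(S_{t₁}'E⁻¹S_{t₁} + W) ≺ 0`. The Woodbury identity is then exactly the formula for `q_{t₁}`, and
maximizing the concave quadratic `B(z, ·) + 𝒬_{t₂}` gives the same matrix. -/

/-! ### Monotonicity and uniqueness off a finite exceptional set -/

/-- A continuous function whose derivative is positive outside a finite set is strictly monotone. -/
theorem strictMonoOn_Icc_of_hasDerivAt_pos {D : Set ℝ} (hD : D.Finite) {f f' : ℝ → ℝ}
    {a b : ℝ} (hf : ContinuousOn f (Icc a b))
    (hd : ∀ t ∈ Ioo a b \ D, HasDerivAt f (f' t) t)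
    (hpos : ∀ t ∈ Ioo a b \ D, 0 < f' t) : StrictMonoOn f (Icc a b) := by
  induction D, hD using Set.Finite.induction_on generalizing a b with
  | empty =>
    refine strictMonoOn_of_deriv_pos (convex_Icc a b) hf fun t ht => ?_
    rw [interior_Icc] at ht
    rw [(hd t ⟨ht, id⟩).deriv]
    exact hpos t ⟨ht, id⟩
  | @insert c D _ _ ih =>
    -- An interval without `c` in its interior falls under the induction hypothesis; when `c` is
    -- interior, the two halves are glued at `c`.
    have key : ∀ u v, a ≤ u → v ≤ b → c ∉ Ioo u v → StrictMonoOn f (Icc u v) := by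
      intro u v hu hv hc
      have hmem : ∀ t ∈ Ioo u v \ D, t ∈ Ioo a b \ insert c D := fun t ht =>
        ⟨Ioo_subset_Ioo hu hv ht.1, fun h => h.elim (fun h => hc (h ▸ ht.1)) ht.2⟩
      exact ih (hf.mono (Icc_subset_Icc hu hv)) (fun t ht => hd t (hmem t ht))
        (fun t ht => hpos t (hmem t ht))
    by_cases hc : c ∈ Ioo a b
    · have h1 := key a c le_rfl hc.2.le (fun h => lt_irrefl _ h.2)
      have h2 := key c b hc.1.le le_rfl (fun h => lt_irrefl _ h.1)
      have := h1.union h2 (isGreatest_Icc hc.1.le) (isLeast_Icc hc.2.le)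
      rwa [Icc_union_Icc_eq_Icc hc.1.le hc.2.le] at this
    · exact key a b le_rfl le_rfl hc

/-- A continuous function whose derivative is nonnegative outside a finite set is monotone. -/
theorem monotoneOn_Icc_of_hasDerivAt_nonneg {D : Set ℝ} (hD : D.Finite) {f f' : ℝ → ℝ}
    {a b : ℝ} (hf : ContinuousOn f (Icc a b))
    (hd : ∀ t ∈ Ioo a b \ D, HasDerivAt f (f' t) t)
    (hpos : ∀ t ∈ Ioo a b \ D, 0 ≤ f' t) : MonotoneOn f (Icc a b) := by
  intro x hx y hy hxy
  rcases hxy.eq_or_lt with rfl | hlt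
  · exact le_rfl
  refine le_of_forall_pos_le_add fun ε hε => ?_
  -- The added slope makes the derivative positive and contributes exactly `ε` between `x` and `y`.
  have hm : StrictMonoOn (fun t => f t + ε / (y - x) * t) (Icc a b) :=
    strictMonoOn_Icc_of_hasDerivAt_pos hD (f' := fun t => f' t + ε / (y - x))
      (hf.add (by fun_prop))
      (fun t ht => by simpa using (hd t ht).fun_add ((hasDerivAt_id t).const_mul (ε / (y - x))))
      (fun t ht => add_pos_of_nonneg_of_pos (hpos t ht) (div_pos hε (sub_pos.2 hlt)))
  have h := (hm hx hy hlt).le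
  have h2 : ε / (y - x) * (y - x) = ε := div_mul_cancel₀ _ (sub_pos.2 hlt).ne'
  simp only at h
  nlinarith

/-- Uniqueness of the zero solution of a differential inequality `|xᵢ'| ≤ K ∑ⱼ |xⱼ|`. -/
theorem eq_zero_of_abs_deriv_le {ι : Type*} [Fintype ι] {D : Set ℝ} (hD : D.Finite)
    {x x' : ι → ℝ → ℝ} {a b K s : ℝ} (hx : ∀ i, ContinuousOn (x i) (Icc a b))
    (hd : ∀ t ∈ Ioo a b \ D, ∀ i, HasDerivAt (x i) (x' i t) t)
    (hK : ∀ t ∈ Ioo a b \ D, ∀ i, |x' i t| ≤ K * ∑ j, |x j t|)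
    (hs : s ∈ Icc a b) (h0 : ∀ i, x i s = 0) : ∀ t ∈ Icc a b, ∀ i, x i t = 0 := by
  classical
  set g : ℝ → ℝ := fun t => ∑ i, x i t ^ 2 with hg
  set g' : ℝ → ℝ := fun t => ∑ i, 2 * x i t * x' i t with hg'
  have hgc : ContinuousOn g (Icc a b) := continuousOn_finsetSum _ fun i _ => (hx i).pow 2
  have hgd : ∀ t ∈ Ioo a b \ D, HasDerivAt g (g' t) t := fun t ht => by
    refine HasDerivAt.fun_sum fun i _ => ?_
    simpa using (hd t ht i).fun_pow 2
  obtain ⟨c, hc⟩ : ∃ c, ∀ t ∈ Ioo a b \ D, |g' t| ≤ c * g t := by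
    -- The cardinality comes from Cauchy–Schwarz, `(∑ |xⱼ|)² ≤ card ι * ∑ xⱼ²`.
    refine ⟨2 * |K| * Fintype.card ι, fun t ht => ?_⟩
    have hS : (0 : ℝ) ≤ ∑ j, |x j t| := Finset.sum_nonneg fun _ _ => abs_nonneg _
    calc |g' t| ≤ ∑ i, |2 * x i t * x' i t| := Finset.abs_sum_le_sum_abs _ _
      _ ≤ ∑ i, 2 * |x i t| * (|K| * ∑ j, |x j t|) := by
        refine Finset.sum_le_sum fun i _ => ?_
        rw [abs_mul, abs_mul, abs_two]
        refine mul_le_mul_of_nonneg_left ((hK t ht i).trans ?_) (by positivity)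
        exact mul_le_mul_of_nonneg_right (le_abs_self K) hS
      _ = 2 * |K| * (∑ j, |x j t|) ^ 2 := by
        rw [← Finset.sum_mul, ← Finset.mul_sum]; ring
      _ ≤ 2 * |K| * (Fintype.card ι * ∑ j, |x j t| ^ 2) := by
        refine mul_le_mul_of_nonneg_left ?_ (by positivity)
        simpa using sq_sum_le_card_mul_sum_sq (s := Finset.univ) (f := fun j => |x j t|)
      _ = 2 * |K| * Fintype.card ι * g t := by simp only [sq_abs, hg]; ring
  have hgn : ∀ t, 0 ≤ g t := fun t => Finset.sum_nonneg fun i _ => sq_nonneg _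
  have hgs : g s = 0 := by simp [hg, h0]
  have hexp : ∀ k t : ℝ, HasDerivAt (fun t => Real.exp (k * t)) (Real.exp (k * t) * k) t :=
    fun k t => by simpa using ((hasDerivAt_id t).const_mul k).exp
  -- Grönwall in both directions: `g e^{ct}` increases, which settles times before `s`, and `g
  -- e^{-ct}` decreases, which settles times after `s`.
  have hup : MonotoneOn (fun t => g t * Real.exp (c * t)) (Icc a b) :=
    monotoneOn_Icc_of_hasDerivAt_nonneg hD (hgc.mul (by fun_prop))
      (fun t ht => (hgd t ht).mul (hexp c t)) fun t ht => by
        have := abs_le.1 (hc t ht)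
        nlinarith [Real.exp_pos (c * t)]
  have hdown : MonotoneOn (fun t => -(g t * Real.exp (-c * t))) (Icc a b) :=
    monotoneOn_Icc_of_hasDerivAt_nonneg hD (hgc.mul (by fun_prop)).neg
      (fun t ht => ((hgd t ht).mul (hexp (-c) t)).neg) fun t ht => by
        have := abs_le.1 (hc t ht)
        nlinarith [Real.exp_pos (-c * t)]
  intro t ht i
  have hgt : g t ≤ 0 := by
    rcases le_total t s with h | h
    · have := hup ht hs h
      simp only [hgs, zero_mul] at this
      exact nonpos_of_mul_nonpos_left this (Real.exp_pos _)
    · have := hdown hs ht h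
      simp only [hgs, zero_mul, neg_zero] at this
      exact nonpos_of_mul_nonpos_left (neg_nonneg.1 this) (Real.exp_pos _)
  have hz := (Finset.sum_eq_zero_iff_of_nonneg fun i _ => sq_nonneg (x i t)).1
    (le_antisymm hgt (hgn t)) i (Finset.mem_univ i)
  exact pow_eq_zero_iff two_ne_zero |>.1 hz

/-! ### Bounded matrix functions -/

/-- Entrywise boundedness of a matrix function on `[a, b]`. -/
def EntryBounded {n : ℕ} (a b : ℝ) (M : ℝ → Matrix (Fin n) (Fin n) ℝ) : Prop :=
  ∃ K : ℝ, ∀ t ∈ Icc a b, ∀ i j, |M t i j| ≤ K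

namespace EntryBounded

variable {n : ℕ} {a b : ℝ} {M N : ℝ → Matrix (Fin n) (Fin n) ℝ}

theorem add (hM : EntryBounded a b M) (hN : EntryBounded a b N) :
    EntryBounded a b fun t => M t + N t := by
  obtain ⟨K, hK⟩ := hM
  obtain ⟨L, hL⟩ := hN
  exact ⟨K + L, fun t ht i j => (abs_add_le _ _).trans (add_le_add (hK t ht i j) (hL t ht i j))⟩

theorem mul (hM : EntryBounded a b M) (hN : EntryBounded a b N) :
    EntryBounded a b fun t => M t * N t := by
  obtain ⟨K, hK⟩ := hM
  obtain ⟨L, hL⟩ := hN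
  refine ⟨∑ _k : Fin n, K * L, fun t ht i j => ?_⟩
  simp only [Matrix.mul_apply]
  refine (Finset.abs_sum_le_sum_abs _ _).trans (Finset.sum_le_sum fun k _ => ?_)
  rw [abs_mul]
  exact mul_le_mul (hK t ht i k) (hL t ht k j) (abs_nonneg _)
    ((abs_nonneg _).trans (hK t ht i k))

theorem neg (hM : EntryBounded a b M) : EntryBounded a b fun t => -M t := by
  obtain ⟨K, hK⟩ := hM
  exact ⟨K, fun t ht i j => by simpa using hK t ht i j⟩

theorem transpose (hM : EntryBounded a b M) : EntryBounded a b fun t => (M t)ᵀ := by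
  obtain ⟨K, hK⟩ := hM
  exact ⟨K, fun t ht i j => hK t ht j i⟩

theorem of_continuousOn (hM : ContinuousOn M (Icc a b)) : EntryBounded a b M := by
  have h : ∀ i j, ∃ K, ∀ t ∈ Icc a b, |M t i j| ≤ K := fun i j => by
    have : ContinuousOn (fun t => M t i j) (Icc a b) :=
      (continuous_id.matrix_elem i j).comp_continuousOn hM
    exact isCompact_Icc.exists_bound_of_continuousOn this
  choose K hK using h
  refine ⟨∑ i, ∑ j, |K i j|, fun t ht i j => (hK i j t ht).trans ((le_abs_self _).trans ?_)⟩
  refine le_trans ?_ (Finset.single_le_sum (f := fun i => ∑ j, |K i j|)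
    (fun i _ => Finset.sum_nonneg fun _ _ => abs_nonneg _) (Finset.mem_univ i))
  exact Finset.single_le_sum (f := fun j => |K i j|) (fun _ _ => abs_nonneg _) (Finset.mem_univ j)

end EntryBounded

/-! ### Derivatives of matrix products, transposes and inverses -/

namespace HasDerivAt

variable {l m n : Type*} [Fintype n] {t : ℝ}

theorem matrix_iff {X : ℝ → Matrix m n ℝ} {X' : Matrix m n ℝ} :
    HasDerivAt X X' t ↔ ∀ i j, HasDerivAt (fun t => X t i j) (X' i j) t :=
  hasDerivAt_pi.trans (forall_congr' fun _ => hasDerivAt_pi)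

theorem matrix_mul [Fintype m] {X : ℝ → Matrix l m ℝ} {Y : ℝ → Matrix m n ℝ} {X' : Matrix l m ℝ}
    {Y' : Matrix m n ℝ} (hX : HasDerivAt X X' t) (hY : HasDerivAt Y Y' t) :
    HasDerivAt (fun t => X t * Y t) (X' * Y t + X t * Y') t := by
  rw [matrix_iff] at *
  intro i j
  simp only [Matrix.mul_apply, Matrix.add_apply, ← Finset.sum_add_distrib]
  exact HasDerivAt.fun_sum fun k _ => (hX i k).mul (hY k j)

theorem matrix_transpose [Fintype m] {X : ℝ → Matrix m n ℝ} {X' : Matrix m n ℝ} (hX : HasDerivAt X X' t) :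
    HasDerivAt (fun t => (X t)ᵀ) X'ᵀ t := by
  rw [matrix_iff] at *
  exact fun i j => hX j i

theorem matrix_const (M : Matrix m n ℝ) [Fintype m] : HasDerivAt (fun _ => M) 0 t :=
  matrix_iff.2 fun i j => hasDerivAt_const t (M i j)

theorem matrix_sub [Fintype m] {X Y : ℝ → Matrix m n ℝ} {X' Y' : Matrix m n ℝ}
    (hX : HasDerivAt X X' t) (hY : HasDerivAt Y Y' t) :
    HasDerivAt (fun t => X t - Y t) (X' - Y') t := by
  rw [matrix_iff] at *
  exact fun i j => (hX i j).fun_sub (hY i j)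

theorem matrix_of_hasDerivWithinAt [Fintype m] {X : ℝ → Matrix m n ℝ} {X' : Matrix m n ℝ}
    {s : Set ℝ} (hX : HasDerivWithinAt X X' s t) (hs : s ∈ nhds t) : HasDerivAt X X' t :=
  matrix_iff.2 fun i j =>
    (hasDerivWithinAt_pi.1 (hasDerivWithinAt_pi.1 hX i) j).hasDerivAt hs

-- Inversion is differentiated as a map on a complete normed algebra; the operator norm only serves
-- to supply that structure.
open scoped Matrix.Norms.Operator in
theorem matrix_inv [DecidableEq n] {X : ℝ → Matrix n n ℝ} {X' : Matrix n n ℝ}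
    (hX : HasDerivAt X X' t) (hu : IsUnit (X t)) :
    HasDerivAt (fun t => (X t)⁻¹) (-((X t)⁻¹ * X' * (X t)⁻¹)) t := by
  obtain ⟨u, hu⟩ := hu
  have h := hasFDerivAt_ringInverse (𝕜 := ℝ) u
  rw [hu] at h
  have h2 := h.comp_hasDerivAt t hX
  simp only [Matrix.nonsing_inv_eq_ringInverse]
  rw [← hu]
  simp only [Function.comp_def, _root_.neg_apply, ContinuousLinearMap.mulLeftRight_apply,
    ← Ring.inverse_unit] at h2
  exact h2

end HasDerivAt

/-! ### Uniqueness for linear matrix equations -/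

/-- A solution of `X' = L X + X R` with bounded coefficients that vanishes somewhere is zero. -/
theorem eq_zero_of_linear_matrix_ode {n : ℕ} {a b s : ℝ} {D : Set ℝ} (hD : D.Finite)
    {L R X : ℝ → Matrix (Fin n) (Fin n) ℝ} (hL : EntryBounded a b L) (hR : EntryBounded a b R)
    (hX : ContinuousOn X (Icc a b))
    (hd : ∀ t ∈ Ioo a b \ D, HasDerivAt X (L t * X t + X t * R t) t)
    (hs : s ∈ Icc a b) (h0 : X s = 0) : ∀ t ∈ Icc a b, X t = 0 := by
  obtain ⟨K, hK⟩ := hL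
  obtain ⟨K', hK'⟩ := hR
  have key := eq_zero_of_abs_deriv_le (ι := Fin n × Fin n) hD
    (x := fun i t => X t i.1 i.2) (x' := fun i t => (L t * X t + X t * R t) i.1 i.2)
    (K := |K| + |K'|) (fun i => (continuous_id.matrix_elem i.1 i.2).comp_continuousOn hX)
    (fun t ht i => HasDerivAt.matrix_iff.1 (hd t ht) i.1 i.2) ?_ hs (fun i => by simp [h0])
  · intro t ht
    ext i j
    exact key t ht (i, j)
  · rintro t ⟨ht, -⟩ ⟨i, j⟩
    have htI := Ioo_subset_Icc_self ht
    have hcol : ∑ k, |X t k j| ≤ ∑ q : Fin n × Fin n, |X t q.1 q.2| := by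
      rw [Fintype.sum_prod_type]
      exact Finset.sum_le_sum fun k _ => Finset.single_le_sum (f := fun j => |X t k j|)
        (fun _ _ => abs_nonneg _) (Finset.mem_univ j)
    have hrow : ∑ k, |X t i k| ≤ ∑ q : Fin n × Fin n, |X t q.1 q.2| := by
      rw [Fintype.sum_prod_type]
      exact Finset.single_le_sum (f := fun i => ∑ k, |X t i k|)
        (fun _ _ => Finset.sum_nonneg fun _ _ => abs_nonneg _) (Finset.mem_univ i)
    have h1 : |(L t * X t) i j| ≤ |K| * ∑ k, |X t k j| := by
      rw [Matrix.mul_apply, Finset.mul_sum]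
      refine (Finset.abs_sum_le_sum_abs _ _).trans (Finset.sum_le_sum fun k _ => ?_)
      rw [abs_mul]
      exact mul_le_mul_of_nonneg_right ((hK t htI i k).trans (le_abs_self K)) (abs_nonneg _)
    have h2 : |(X t * R t) i j| ≤ |K'| * ∑ k, |X t i k| := by
      rw [Matrix.mul_apply, Finset.mul_sum]
      refine (Finset.abs_sum_le_sum_abs _ _).trans (Finset.sum_le_sum fun k _ => ?_)
      rw [abs_mul, mul_comm]
      exact mul_le_mul_of_nonneg_right ((hK' t htI k j).trans (le_abs_self K')) (abs_nonneg _)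
    calc |(L t * X t + X t * R t) i j| ≤ |(L t * X t) i j| + |(X t * R t) i j| := abs_add_le _ _
      _ ≤ _ := by
        rw [add_mul]
        exact add_le_add (h1.trans (mul_le_mul_of_nonneg_left hcol (abs_nonneg _)))
          (h2.trans (mul_le_mul_of_nonneg_left hrow (abs_nonneg _)))

/-! ### Positive definite matrices and their continuous paths -/

section Positivity

variable {n : ℕ}

theorem Matrix.IsSymm.isHermitian_real {M : Matrix (Fin n) (Fin n) ℝ} (h : M.IsSymm) :
    M.IsHermitian := Matrix.isHermitian_iff_isSymm.2 h

theorem Matrix.PosDef.isSymm_real {M : Matrix (Fin n) (Fin n) ℝ} (h : M.PosDef) : M.IsSymm :=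
  Matrix.isHermitian_iff_isSymm.1 h.isHermitian

theorem Matrix.PosDef.isUnit_det {M : Matrix (Fin n) (Fin n) ℝ} (h : M.PosDef) :
    IsUnit M.det := isUnit_iff_ne_zero.2 h.det_pos.ne'

theorem Matrix.posDef_real_iff {M : Matrix (Fin n) (Fin n) ℝ} (h : M.IsSymm) :
    M.PosDef ↔ ∀ x ≠ 0, 0 < x ⬝ᵥ M *ᵥ x := by
  rw [Matrix.posDef_iff_dotProduct_mulVec]
  exact ⟨fun hM x hx => hM.2 hx, fun hM => ⟨h.isHermitian_real, fun x hx => hM x hx⟩⟩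

/-- Congruence by an invertible matrix preserves positive definiteness. -/
theorem Matrix.PosDef.transpose_mul_mul {M S : Matrix (Fin n) (Fin n) ℝ} (h : M.PosDef)
    (hS : IsUnit S.det) : (Sᵀ * M * S).PosDef := by
  rw [← Matrix.conjTranspose_eq_transpose_of_trivial]
  exact h.conjTranspose_mul_mul_same
    (Matrix.mulVec_injective_iff_isUnit.2 ((Matrix.isUnit_iff_isUnit_det S).2 hS))

theorem Matrix.posDef_of_posSemidef_of_isUnit_det {M : Matrix (Fin n) (Fin n) ℝ}
    (h : M.PosSemidef) (hu : IsUnit M.det) : M.PosDef :=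
  (h.posDef_iff_isUnit).2 ((Matrix.isUnit_iff_isUnit_det M).2 hu)

/-- A continuous path of invertible symmetric matrices stays positive definite. -/
theorem posDef_of_continuousOn_of_isUnit {a b : ℝ} {W : ℝ → Matrix (Fin n) (Fin n) ℝ}
    (hW : ContinuousOn W (Icc a b)) (hsymm : ∀ t ∈ Icc a b, (W t).IsSymm)
    (hu : ∀ t ∈ Icc a b, IsUnit (W t).det) {s : ℝ} (hs : s ∈ Icc a b) (h : (W s).PosDef) :
    ∀ t ∈ Icc a b, (W t).PosDef := by
  have hWc : Continuous fun t : Icc a b => W t := continuousOn_iff_continuous_domRestrict.1 hW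
  set G : Set (Icc a b) := {t | (W t).PosDef} with hG
  have hopen : IsOpen G := by
    rw [isOpen_iff_mem_nhds]
    intro t ht
    have hq : Continuous fun z : Icc a b × (Fin n → ℝ) => z.2 ⬝ᵥ W z.1 *ᵥ z.2 :=
      continuous_snd.dotProduct ((hWc.comp continuous_fst).matrix_mulVec continuous_snd)
    -- Compactness of the unit sphere makes positivity at `t` uniform in `x`, so it persists for
    -- nearby times; homogeneity extends it to all `x ≠ 0`.
    have key : ∀ᶠ u in nhds t, ∀ x ∈ Metric.sphere (0 : Fin n → ℝ) 1,
        0 < x ⬝ᵥ W (u : Icc a b) *ᵥ x := by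
      refine (isCompact_sphere (0 : Fin n → ℝ) 1).eventually_forall_of_forall_eventually
        fun x hx => ?_
      refine hq.continuousAt.eventually (lt_mem_nhds (a := 0) ?_)
      refine (Matrix.posDef_real_iff (hsymm t t.2)).1 ht x fun h0 => ?_
      simp [h0] at hx
    refine key.mono fun u hu => ?_
    refine (Matrix.posDef_real_iff (hsymm u u.2)).2 fun x hx => ?_
    have hn : 0 < ‖x‖ := norm_pos_iff.2 hx
    have h1 := hu (‖x‖⁻¹ • x) (by simp [norm_smul, hn.ne'])
    rw [Matrix.mulVec_smul, smul_dotProduct, dotProduct_smul, smul_smul, smul_eq_mul] at h1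
    exact pos_of_mul_pos_right h1 (by positivity)
  have hclosed : IsClosed G := by
    -- As every `W t` is invertible, definiteness coincides with semidefiniteness, which is a closed
    -- condition.
    have : G = ⋂ x : Fin n → ℝ, {t | 0 ≤ x ⬝ᵥ W (t : Icc a b) *ᵥ x} := by
      ext t
      simp only [mem_iInter, mem_ofPred_eq, hG]
      refine ⟨fun ht x => ?_, fun ht => ?_⟩
      · simpa using ht.posSemidef.dotProduct_mulVec_nonneg x
      · exact Matrix.posDef_of_posSemidef_of_isUnit_det
          (.of_dotProduct_mulVec_nonneg (hsymm t t.2).isHermitian_real (by simpa using ht))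
          (hu t t.2)
    rw [this]
    exact isClosed_iInter fun x => isClosed_le continuous_const
      (continuous_const.dotProduct (hWc.matrix_mulVec continuous_const))
  have : PreconnectedSpace (Icc a b) := Subtype.preconnectedSpace isPreconnected_Icc
  have huniv := (IsClopen.eq_univ ⟨hclosed, hopen⟩ ⟨⟨s, hs⟩, h⟩ : G = univ)
  intro t ht
  exact (huniv ▸ mem_univ (⟨t, ht⟩ : Icc a b) : (⟨t, ht⟩ : Icc a b) ∈ G)

end Positivity

/-! ### Infima and suprema of quadratic functions -/

section Quadratic

variable {n : ℕ}

theorem Matrix.IsSymm.dotProduct_mulVec_comm {M : Matrix (Fin n) (Fin n) ℝ} (h : M.IsSymm)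
    (x y : Fin n → ℝ) : x ⬝ᵥ M *ᵥ y = y ⬝ᵥ M *ᵥ x := by
  rw [Matrix.dotProduct_mulVec, ← Matrix.mulVec_transpose, h.eq, dotProduct_comm]

theorem mulVec_dotProduct_mulVec (M N : Matrix (Fin n) (Fin n) ℝ) (x y : Fin n → ℝ) :
    (M *ᵥ x) ⬝ᵥ N *ᵥ y = x ⬝ᵥ (Mᵀ * N) *ᵥ y := by
  rw [← Matrix.mulVec_mulVec, Matrix.dotProduct_mulVec x, Matrix.vecMul_transpose]

/-- Completion of the square. -/
theorem quad_add_linear_eq {G : Matrix (Fin n) (Fin n) ℝ} (hG : G.IsSymm) (hu : IsUnit G.det)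
    (x b : Fin n → ℝ) :
    (1 / 2) * (x ⬝ᵥ G *ᵥ x) + x ⬝ᵥ b =
      (1 / 2) * ((x + G⁻¹ *ᵥ b) ⬝ᵥ G *ᵥ (x + G⁻¹ *ᵥ b)) - (1 / 2) * (b ⬝ᵥ G⁻¹ *ᵥ b) := by
  have h1 : G *ᵥ (G⁻¹ *ᵥ b) = b := by
    rw [Matrix.mulVec_mulVec, Matrix.mul_nonsing_inv _ hu, Matrix.one_mulVec]
  have h2 : (G⁻¹ *ᵥ b) ⬝ᵥ G *ᵥ x = x ⬝ᵥ b := by rw [hG.dotProduct_mulVec_comm, h1]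
  rw [Matrix.mulVec_add, h1, add_dotProduct, dotProduct_add, dotProduct_add, h2,
    dotProduct_comm (G⁻¹ *ᵥ b) b]
  ring

theorem iInf_quad_add_linear {G : Matrix (Fin n) (Fin n) ℝ} (hG : G.PosDef) (b : Fin n → ℝ)
    (c : ℝ) :
    ⨅ x : Fin n → ℝ, (((1 / 2) * (x ⬝ᵥ G *ᵥ x) + x ⬝ᵥ b + c : ℝ) : EReal) =
      ((c - (1 / 2) * (b ⬝ᵥ G⁻¹ *ᵥ b) : ℝ) : EReal) := by
  simp only [quad_add_linear_eq hG.isSymm_real hG.isUnit_det]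
  refine le_antisymm (iInf_le_of_le (-(G⁻¹ *ᵥ b)) ?_) (le_iInf fun x => ?_)
  · rw [EReal.coe_le_coe_iff]
    simp only [neg_add_cancel, Matrix.mulVec_zero, dotProduct_zero]
    linarith
  · rw [EReal.coe_le_coe_iff]
    have : 0 ≤ (x + G⁻¹ *ᵥ b) ⬝ᵥ G *ᵥ (x + G⁻¹ *ᵥ b) := by
      simpa using hG.posSemidef.dotProduct_mulVec_nonneg (x + G⁻¹ *ᵥ b)
    linarith

theorem iSup_linear_sub_quad {G : Matrix (Fin n) (Fin n) ℝ} (hG : G.PosDef) (b : Fin n → ℝ)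
    (c : ℝ) :
    ⨆ x : Fin n → ℝ, ((c + x ⬝ᵥ b - (1 / 2) * (x ⬝ᵥ G *ᵥ x) : ℝ) : EReal) =
      ((c + (1 / 2) * (b ⬝ᵥ G⁻¹ *ᵥ b) : ℝ) : EReal) := by
  have hid : ∀ x : Fin n → ℝ, c + x ⬝ᵥ b - (1 / 2) * (x ⬝ᵥ G *ᵥ x) =
      c + (1 / 2) * (b ⬝ᵥ G⁻¹ *ᵥ b)
        - (1 / 2) * ((x + G⁻¹ *ᵥ -b) ⬝ᵥ G *ᵥ (x + G⁻¹ *ᵥ -b)) := fun x => by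
    have := quad_add_linear_eq hG.isSymm_real hG.isUnit_det x (-b)
    rw [dotProduct_neg, neg_dotProduct b, Matrix.mulVec_neg, dotProduct_neg b, neg_neg] at this
    rw [Matrix.mulVec_neg]
    linarith
  simp only [hid]
  refine le_antisymm (iSup_le fun x => ?_) (le_iSup_of_le (-(G⁻¹ *ᵥ -b)) ?_)
  · rw [EReal.coe_le_coe_iff]
    have : 0 ≤ (x + G⁻¹ *ᵥ -b) ⬝ᵥ G *ᵥ (x + G⁻¹ *ᵥ -b) := by
      simpa using hG.posSemidef.dotProduct_mulVec_nonneg (x + G⁻¹ *ᵥ -b)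
    linarith
  · rw [EReal.coe_le_coe_iff]
    simp only [neg_add_cancel, Matrix.mulVec_zero, dotProduct_zero]
    linarith

/-- A quadratic that stays bounded below under every linear perturbation is positive definite. -/
theorem posDef_of_forall_linear_bddBelow {G : Matrix (Fin n) (Fin n) ℝ} (hG : G.IsSymm)
    (h : ∀ b : Fin n → ℝ, ∃ m : ℝ, ∀ x : Fin n → ℝ, m ≤ (1 / 2) * (x ⬝ᵥ G *ᵥ x) + x ⬝ᵥ b) :
    G.PosDef := by
  refine (Matrix.posDef_real_iff hG).2 fun x hx => ?_
  by_contra! hle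
  obtain ⟨m, hm⟩ := h (-x)
  have hxx : 0 < x ⬝ᵥ x := by
    refine lt_of_le_of_ne (Finset.sum_nonneg fun i _ => mul_self_nonneg _) fun h0 => hx ?_
    exact dotProduct_self_eq_zero.1 h0.symm
  -- Along the ray through `x` the quadratic part is at most zero; this multiple makes the linear
  -- term `-(|m| + 1)`, which is below `m`.
  have h1 := hm (((|m| + 1) / (x ⬝ᵥ x)) • x)
  rw [Matrix.mulVec_smul, smul_dotProduct, dotProduct_smul, smul_dotProduct, dotProduct_neg] at h1
  simp only [smul_eq_mul] at h1
  have h2 : (|m| + 1) / (x ⬝ᵥ x) * -(x ⬝ᵥ x) = -(|m| + 1) := by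
    field_simp
  rw [h2, ← mul_assoc ((|m| + 1) / (x ⬝ᵥ x))] at h1
  have h3 := mul_nonpos_of_nonneg_of_nonpos
    (mul_self_nonneg ((|m| + 1) / (x ⬝ᵥ x))) hle
  have := neg_abs_le m
  linarith

theorem eq_of_isSymm_of_quadForm_eq {M N : Matrix (Fin n) (Fin n) ℝ} (hM : M.IsSymm)
    (hN : N.IsSymm) (h : ∀ z, z ⬝ᵥ M *ᵥ z = z ⬝ᵥ N *ᵥ z) : M = N := by
  -- Polarization.
  have hpol : ∀ x y : Fin n → ℝ, x ⬝ᵥ M *ᵥ y = x ⬝ᵥ N *ᵥ y := fun x y => by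
    have h1 := h (x + y)
    simp only [Matrix.mulVec_add, add_dotProduct, dotProduct_add] at h1
    rw [h x, h y, hM.dotProduct_mulVec_comm y x, hN.dotProduct_mulVec_comm y x] at h1
    linarith
  ext i j
  simpa using hpol (Pi.single i 1) (Pi.single j 1)

/-- The semiconvex dual of a quadratic whose shifted Hessian is positive definite. -/
theorem semiconvexDual_quad {p P S Q : Matrix (Fin n) (Fin n) ℝ} (hG : (p - P).PosDef)
    (z : Fin n → ℝ) :
    (⨅ x, ((quadFun p x : ℝ) : EReal) - ((biquadFun P S Q x z : ℝ) : EReal)) =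
      ((quadFun (-(Sᵀ * (p - P)⁻¹ * S) - Q) z : ℝ) : EReal) := by
  have hterm : ∀ x, ((quadFun p x : ℝ) : EReal) - ((biquadFun P S Q x z : ℝ) : EReal) =
      (((1 / 2) * (x ⬝ᵥ (p - P) *ᵥ x) + x ⬝ᵥ -(S *ᵥ z) + -((1 / 2) * (z ⬝ᵥ Q *ᵥ z)) : ℝ) :
        EReal) := fun x => by
    rw [← EReal.coe_sub, quadFun, biquadFun, Matrix.sub_mulVec, dotProduct_sub, dotProduct_neg]
    congr 1
    ring
  simp only [hterm]
  rw [iInf_quad_add_linear hG, quadFun, Matrix.mulVec_neg, neg_dotProduct, dotProduct_neg, neg_neg,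
    Matrix.mulVec_mulVec, mulVec_dotProduct_mulVec, Matrix.sub_mulVec, Matrix.neg_mulVec,
    dotProduct_sub, dotProduct_neg, Matrix.mul_assoc]
  congr 1
  ring

/-- Finiteness of the semiconvex dual forces the shifted Hessian to be positive definite. -/
theorem posDef_of_semiconvexDual_finite {p P S Q : Matrix (Fin n) (Fin n) ℝ}
    (hsymm : (p - P).IsSymm) (hS : IsUnit S.det) {q : (Fin n → ℝ) → ℝ}
    (h : ∀ z, (⨅ x, ((quadFun p x : ℝ) : EReal) - ((biquadFun P S Q x z : ℝ) : EReal)) =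
      ((q z : ℝ) : EReal)) : (p - P).PosDef := by
  refine posDef_of_forall_linear_bddBelow hsymm fun b => ?_
  -- Invertibility of `S` lets the cross term `-x'Sz` realize any prescribed linear form `x'b`.
  set z := S⁻¹ *ᵥ -b with hz
  have hSz : S *ᵥ z = -b := by
    rw [hz, Matrix.mulVec_mulVec, Matrix.mul_nonsing_inv _ hS, Matrix.one_mulVec]
  refine ⟨q z + (1 / 2) * (z ⬝ᵥ Q *ᵥ z), fun x => ?_⟩
  have h1 := (h z).symm.le.trans (iInf_le _ x)
  rw [← EReal.coe_sub, EReal.coe_le_coe_iff, quadFun, biquadFun, hSz, dotProduct_neg] at h1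
  rw [Matrix.sub_mulVec, dotProduct_sub]
  linarith

/-- The dual kernel of two bivariate quadratics. -/
theorem dualKernel_biquad {P₁ P₂ S₁ S₂ Q₁ Q₂ : Matrix (Fin n) (Fin n) ℝ} (hE : (P₁ - P₂).PosDef)
    (z y : Fin n → ℝ) :
    (⨅ x, ((biquadFun P₁ S₁ Q₁ x y : ℝ) : EReal) - ((biquadFun P₂ S₂ Q₂ x z : ℝ) : EReal)) =
      ((biquadFun (dualB11 P₁ P₂ S₂ Q₂) (dualB12 P₁ P₂ S₁ S₂) (dualB22 P₁ P₂ S₁ Q₁) z y : ℝ) :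
        EReal) := by
  have hterm : ∀ x, ((biquadFun P₁ S₁ Q₁ x y : ℝ) : EReal) -
      ((biquadFun P₂ S₂ Q₂ x z : ℝ) : EReal) =
      (((1 / 2) * (x ⬝ᵥ (P₁ - P₂) *ᵥ x) + x ⬝ᵥ (S₁ *ᵥ y - S₂ *ᵥ z)
        + ((1 / 2) * (y ⬝ᵥ Q₁ *ᵥ y) - (1 / 2) * (z ⬝ᵥ Q₂ *ᵥ z)) : ℝ) : EReal) := fun x => by
    rw [← EReal.coe_sub, biquadFun, biquadFun, Matrix.sub_mulVec, dotProduct_sub, dotProduct_sub]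
    congr 1
    ring
  simp only [hterm]
  rw [iInf_quad_add_linear hE]
  have hcross : (S₁ *ᵥ y) ⬝ᵥ (P₁ - P₂)⁻¹ *ᵥ (S₂ *ᵥ z) =
      (S₂ *ᵥ z) ⬝ᵥ (P₁ - P₂)⁻¹ *ᵥ (S₁ *ᵥ y) := hE.inv.isSymm_real.dotProduct_mulVec_comm _ _
  rw [Matrix.mulVec_sub, sub_dotProduct, dotProduct_sub, dotProduct_sub, hcross]
  simp only [biquadFun, dualB11, dualB12, dualB22, Matrix.sub_mulVec, Matrix.add_mulVec,
    Matrix.neg_mulVec, dotProduct_sub, dotProduct_add, dotProduct_neg, Matrix.mulVec_mulVec,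
    mulVec_dotProduct_mulVec, Matrix.mul_assoc]
  congr 1
  ring

/-- The semiconvex primal of a quadratic under a bivariate quadratic kernel. -/
theorem iSup_biquad_add_quad {B₁₁ B₁₂ B₂₂ q : Matrix (Fin n) (Fin n) ℝ}
    (hM : (-(B₂₂ + q)).PosDef) (z : Fin n → ℝ) :
    (⨆ y, ((biquadFun B₁₁ B₁₂ B₂₂ z y : ℝ) : EReal) + ((quadFun q y : ℝ) : EReal)) =
      ((quadFun (B₁₁ - B₁₂ * (B₂₂ + q)⁻¹ * B₁₂ᵀ) z : ℝ) : EReal) := by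
  have hu : IsUnit (B₂₂ + q) := IsUnit.neg_iff _ |>.1 ((Matrix.isUnit_iff_isUnit_det _).2 hM.isUnit_det)
  have hterm : ∀ y, ((biquadFun B₁₁ B₁₂ B₂₂ z y : ℝ) : EReal) + ((quadFun q y : ℝ) : EReal) =
      (((1 / 2) * (z ⬝ᵥ B₁₁ *ᵥ z) + y ⬝ᵥ (B₁₂ᵀ *ᵥ z) - (1 / 2) * (y ⬝ᵥ (-(B₂₂ + q)) *ᵥ y) : ℝ) :
        EReal) := fun y => by
    rw [← EReal.coe_add, biquadFun, quadFun, Matrix.neg_mulVec, Matrix.add_mulVec, dotProduct_neg,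
      dotProduct_add, Matrix.mulVec_transpose, dotProduct_comm y (z ᵥ* B₁₂),
      ← Matrix.dotProduct_mulVec]
    congr 1
    ring
  have hinv : (-(B₂₂ + q))⁻¹ = -(B₂₂ + q)⁻¹ := by
    refine Matrix.inv_eq_right_inv ?_
    rw [neg_mul_neg, Matrix.mul_nonsing_inv _ ((Matrix.isUnit_iff_isUnit_det _).1 hu)]
  simp only [hterm]
  rw [iSup_linear_sub_quad hM, hinv, quadFun, Matrix.mulVec_mulVec, mulVec_dotProduct_mulVec,
    Matrix.transpose_transpose, Matrix.sub_mulVec, dotProduct_sub, Matrix.neg_mul, Matrix.mul_neg,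
    Matrix.neg_mulVec, dotProduct_neg, Matrix.mul_assoc]
  congr 1
  ring

end Quadratic

/-! ### Solutions of the Riccati equations -/

section Riccati

variable {n : ℕ} {t₁ t₂ : ℝ} {A C Sig P S Q p : ℝ → Matrix (Fin n) (Fin n) ℝ}

theorem SolvesBackward.exists_finite_hasDerivAt
    {F : ℝ → Matrix (Fin n) (Fin n) ℝ → Matrix (Fin n) (Fin n) ℝ} {X : ℝ → Matrix (Fin n) (Fin n) ℝ}
    (h : SolvesBackward t₁ t₂ F X) :
    ∃ D : Set ℝ, D.Finite ∧ ∀ t ∈ Ioo t₁ t₂ \ D, HasDerivAt X (-(F t (X t))) t := by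
  obtain ⟨-, D, hD, hd⟩ := h
  exact ⟨D, hD, fun t ht => .matrix_of_hasDerivWithinAt
    (hd t ⟨Ioo_subset_Icc_self ht.1, ht.2⟩) (Icc_mem_nhds ht.1.1 ht.1.2)⟩

theorem IsPiecewiseCoeff.entryBounded {M : ℝ → Matrix (Fin n) (Fin n) ℝ}
    (h : IsPiecewiseCoeff t₁ t₂ M) : EntryBounded t₁ t₂ M := h.bounded

/-- The Riccati flow preserves symmetry. -/
theorem isSymm_of_riccati (ht : t₁ ≤ t₂) (hA : EntryBounded t₁ t₂ A)
    (hSig : EntryBounded t₁ t₂ Sig) (hCsymm : ∀ t ∈ Icc t₁ t₂, (C t).IsSymm)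
    (hSigsymm : ∀ t ∈ Icc t₁ t₂, (Sig t).IsSymm)
    (hp : SolvesBackward t₁ t₂ (riccatiRHS A C Sig) p) (hpsymm : (p t₂).IsSymm) :
    ∀ t ∈ Icc t₁ t₂, (p t).IsSymm := by
  obtain ⟨D, hD, hd⟩ := hp.exists_finite_hasDerivAt
  have hpb := EntryBounded.of_continuousOn hp.1
  -- The splitting `pΣp - p'Σp' = p'Σ(p - p') + (p - p')Σp` makes the equation for `p - p'` linear,
  -- with coefficients bounded because `p` is continuous.
  have key := eq_zero_of_linear_matrix_ode (X := fun t => p t - (p t)ᵀ) hD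
    (hA.transpose.add (hpb.transpose.mul hSig)).neg (hA.add (hSig.mul hpb)).neg
    (hp.1.sub (continuous_id.matrix_transpose.comp_continuousOn hp.1)) (s := t₂) ?_
    ⟨ht, le_rfl⟩ (by rw [hpsymm.eq, sub_self])
  · exact fun t ht => (sub_eq_zero.1 (key t ht)).symm
  · intro t ht
    convert (hd t ht).matrix_sub (hd t ht).matrix_transpose using 1
    have htI := Ioo_subset_Icc_self ht.1
    simp only [riccatiRHS, Matrix.transpose_neg, Matrix.transpose_add, Matrix.transpose_mul,
      Matrix.transpose_transpose, (hCsymm t htI).eq, (hSigsymm t htI).eq]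
    noncomm_ring

/-- The antisymmetric part has zero derivative off a finite set, so uniqueness with zero
coefficients applies. This is used for `Q`, whose right-hand side `S'ΣS` does not involve `Q`. -/
theorem isSymm_of_solvesBackward_symm (ht : t₁ ≤ t₂)
    {F : ℝ → Matrix (Fin n) (Fin n) ℝ → Matrix (Fin n) (Fin n) ℝ}
    (hF : ∀ t ∈ Icc t₁ t₂, ∀ X, (F t X).IsSymm)
    (hQ : SolvesBackward t₁ t₂ F Q) (hQsymm : (Q t₂).IsSymm) :
    ∀ t ∈ Icc t₁ t₂, (Q t).IsSymm := by
  obtain ⟨D, hD, hd⟩ := hQ.exists_finite_hasDerivAt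
  have h0 : EntryBounded t₁ t₂ fun _ => (0 : Matrix (Fin n) (Fin n) ℝ) := ⟨0, by simp⟩
  have key := eq_zero_of_linear_matrix_ode (X := fun t => Q t - (Q t)ᵀ) hD h0 h0
    (hQ.1.sub (continuous_id.matrix_transpose.comp_continuousOn hQ.1)) (s := t₂) ?_
    ⟨ht, le_rfl⟩ (by rw [hQsymm.eq, sub_self])
  · exact fun t ht => (sub_eq_zero.1 (key t ht)).symm
  · intro t ht
    convert (hd t ht).matrix_sub (hd t ht).matrix_transpose using 1
    rw [Matrix.transpose_neg, (hF t (Ioo_subset_Icc_self ht.1) _).eq]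
    simp

/-- A solution of a linear matrix equation that is invertible at one time is always invertible. -/
theorem isUnit_det_of_linear_ode {L : ℝ → Matrix (Fin n) (Fin n) ℝ} (hL : EntryBounded t₁ t₂ L)
    (hS : SolvesBackward t₁ t₂ (fun t X => L t * X) S) {s : ℝ} (hs : s ∈ Icc t₁ t₂)
    (hu : IsUnit (S s).det) : ∀ t ∈ Icc t₁ t₂, IsUnit (S t).det := by
  obtain ⟨D, hD, hd⟩ := hS.exists_finite_hasDerivAt
  intro t ht
  by_contra hdet
  obtain ⟨v, hv, hSv⟩ := Matrix.exists_mulVec_eq_zero_iff.2 (not_not.1 (isUnit_iff_ne_zero.not.1 hdet))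
  have h0 : EntryBounded t₁ t₂ fun _ => (0 : Matrix (Fin n) (Fin n) ℝ) := ⟨0, by simp⟩
  -- A kernel vector `v` of `S t` is repeated as every column of a square matrix. Then `S u` times
  -- this matrix solves the same linear equation and vanishes at `t`, hence at `s`, where `S s` is
  -- invertible; so `v = 0`.
  have key := eq_zero_of_linear_matrix_ode (X := fun u => S u * Matrix.of fun i _ => v i) hD
    hL.neg h0 (hS.1.mul continuousOn_const) (s := t) ?_ ht ?_ s hs
  · have h1 : (Matrix.of fun i (_ : Fin n) => v i) = 0 := by
      rw [← Matrix.one_mul (Matrix.of fun i (_ : Fin n) => v i), ← Matrix.nonsing_inv_mul _ hu,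
        Matrix.mul_assoc, key, Matrix.mul_zero]
    exact hv (funext fun i => congrFun (congrFun h1 i) i)
  · intro u hu'
    convert (hd u hu').matrix_mul (HasDerivAt.matrix_const (Matrix.of fun i (_ : Fin n) => v i)) using 1
    noncomm_ring
  · ext i j
    exact congrFun hSv i

/-- If `-P'` is positive definite then `P` is strictly decreasing in the Loewner order. -/
theorem sub_posDef_of_solvesBackward (ht : t₁ < t₂)
    {F : ℝ → Matrix (Fin n) (Fin n) ℝ → Matrix (Fin n) (Fin n) ℝ}
    (hP : SolvesBackward t₁ t₂ F P) (hPsymm : ∀ t ∈ Icc t₁ t₂, (P t).IsSymm)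
    (hF : ∀ t ∈ Icc t₁ t₂, (F t (P t)).PosDef) : (P t₁ - P t₂).PosDef := by
  obtain ⟨D, hD, hd⟩ := hP.exists_finite_hasDerivAt
  have h1 : t₁ ∈ Icc t₁ t₂ := ⟨le_rfl, ht.le⟩
  have h2 : t₂ ∈ Icc t₁ t₂ := ⟨ht.le, le_rfl⟩
  refine (Matrix.posDef_real_iff ((hPsymm _ h1).sub (hPsymm _ h2))).2 fun x hx => ?_
  -- Testing against a fixed `x` reduces the Loewner order to a scalar monotonicity statement.
  have hder : ∀ t ∈ Ioo t₁ t₂ \ D, HasDerivAt (fun t => -(x ⬝ᵥ P t *ᵥ x))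
      (x ⬝ᵥ F t (P t) *ᵥ x) t := fun t ht => by
    have h : HasDerivAt (fun t => x ⬝ᵥ P t *ᵥ x) (x ⬝ᵥ (-(F t (P t))) *ᵥ x) t :=
      HasDerivAt.fun_sum fun i _ => HasDerivAt.const_mul (x i) <| by
        simp only [Matrix.mulVec, dotProduct]
        exact HasDerivAt.fun_sum fun j _ =>
          (HasDerivAt.matrix_iff.1 (hd t ht) i j).mul_const (x j)
    simpa [Matrix.neg_mulVec] using h.fun_neg
  have hmono : StrictMonoOn (fun t => -(x ⬝ᵥ P t *ᵥ x)) (Icc t₁ t₂) := by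
    refine strictMonoOn_Icc_of_hasDerivAt_pos hD ?_ hder fun t ht =>
      (Matrix.posDef_real_iff (hF t (Ioo_subset_Icc_self ht.1)).isSymm_real).1
        (hF t (Ioo_subset_Icc_self ht.1)) x hx
    have hc : Continuous fun M : Matrix (Fin n) (Fin n) ℝ => -(x ⬝ᵥ M *ᵥ x) :=
      (continuous_const.dotProduct (continuous_id.matrix_mulVec continuous_const)).neg
    exact hc.comp_continuousOn hP.1
  have := hmono h1 h2 ht
  simp only at this
  rw [Matrix.sub_mulVec, dotProduct_sub]
  linarith

/-- The difference of two solutions of the Riccati equation, expressed through the solution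
`(P, S, Q)` of the bivariate equations. -/
theorem riccati_sub_eq (ht : t₁ ≤ t₂) (hA : EntryBounded t₁ t₂ A) (hSig : EntryBounded t₁ t₂ Sig)
    (hSigsymm : ∀ t ∈ Icc t₁ t₂, (Sig t).IsSymm)
    (hp : SolvesBackward t₁ t₂ (riccatiRHS A C Sig) p)
    (hPSQ : SolvesBivariateRiccati t₁ t₂ A C Sig P S Q)
    (hPsymm : ∀ t ∈ Icc t₁ t₂, (P t).IsSymm) (hQsymm : (Q t₂).IsSymm) (hS : IsUnit (S t₂).det)
    (hD : (p t₂ - P t₂).PosDef) :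
    ∀ t ∈ Icc t₁ t₂, IsUnit (S t).det ∧
      ((S t₂)ᵀ * (p t₂ - P t₂)⁻¹ * S t₂ + Q t₂ - Q t).PosDef ∧
      p t - P t = S t * ((S t₂)ᵀ * (p t₂ - P t₂)⁻¹ * S t₂ + Q t₂ - Q t)⁻¹ * (S t)ᵀ := by
  have h2 : t₂ ∈ Icc t₁ t₂ := ⟨ht, le_rfl⟩
  have hSu := isUnit_det_of_linear_ode
    (hA.add (hSig.mul (EntryBounded.of_continuousOn hPSQ.eqP.1))).transpose hPSQ.eqS h2 hS
  have hQs := isSymm_of_solvesBackward_symm ht (fun t ht _ => by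
    simp [Matrix.IsSymm, Matrix.transpose_mul, (hSigsymm t ht).eq, Matrix.mul_assoc])
    hPSQ.eqQ hQsymm
  set W : ℝ → Matrix (Fin n) (Fin n) ℝ :=
    fun t => (S t₂)ᵀ * (p t₂ - P t₂)⁻¹ * S t₂ + Q t₂ - Q t with hW
  obtain ⟨Dp, hDp, hdp⟩ := hp.exists_finite_hasDerivAt
  obtain ⟨DP, hDP, hdP⟩ := hPSQ.eqP.exists_finite_hasDerivAt
  obtain ⟨DS, hDS, hdS⟩ := hPSQ.eqS.exists_finite_hasDerivAt
  obtain ⟨DQ, hDQ, hdQ⟩ := hPSQ.eqQ.exists_finite_hasDerivAt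
  have hDc : ContinuousOn (fun t => p t - P t) (Icc t₁ t₂) := hp.1.sub hPSQ.eqP.1
  have hWc : ContinuousOn W (Icc t₁ t₂) := continuousOn_const.sub hPSQ.eqQ.1
  have hTc : ContinuousOn (fun t => (S t)⁻¹) (Icc t₁ t₂) := fun t ht =>
    (continuousAt_matrix_inv _ (by
      rw [Ring.inverse_eq_inv']
      exact continuousAt_inv₀ (hSu t ht).ne_zero)).comp_continuousWithinAt (hPSQ.eqS.1 t ht)
  have hTtc : ContinuousOn (fun t => ((S t)⁻¹)ᵀ) (Icc t₁ t₂) :=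
    continuous_id.matrix_transpose.comp_continuousOn hTc
  have h0 : EntryBounded t₁ t₂ fun _ => (0 : Matrix (Fin n) (Fin n) ℝ) := ⟨0, by simp⟩
  -- `X = YW - 1` satisfies `X' = -(S⁻¹(p - P)ΣS) X`. Working with `YW - 1` avoids assuming that `p
  -- - P` or `W` is invertible at intermediate times; invertibility follows from `YW = 1`.
  have key := eq_zero_of_linear_matrix_ode
    (X := fun t => (S t)⁻¹ * (p t - P t) * ((S t)⁻¹)ᵀ * W t - 1)
    (((hDp.union hDP).union hDS).union hDQ)
    ((((EntryBounded.of_continuousOn hTc).mul (EntryBounded.of_continuousOn hDc)).mul hSig).mul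
      (EntryBounded.of_continuousOn hPSQ.eqS.1)).neg h0
    ((((hTc.mul hDc).mul hTtc).mul hWc).sub continuousOn_const) (s := t₂) ?_ h2 ?_
  · have hYW : ∀ t ∈ Icc t₁ t₂, (S t)⁻¹ * (p t - P t) * ((S t)⁻¹)ᵀ * W t = 1 := fun t ht =>
      sub_eq_zero.1 (key t ht)
    have hWu : ∀ t ∈ Icc t₁ t₂, IsUnit (W t).det := fun t ht =>
      Matrix.isUnit_det_of_left_inverse (hYW t ht)
    have hW2 : W t₂ = (S t₂)ᵀ * (p t₂ - P t₂)⁻¹ * S t₂ := by simp [hW]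
    have hW2pos : (W t₂).PosDef := hW2 ▸ hD.inv.transpose_mul_mul hS
    have hWs : ∀ t ∈ Icc t₁ t₂, (W t).IsSymm := fun t ht => by
      have : W t = W t₂ + Q t₂ - Q t := by rw [hW2]
      rw [this]
      exact (hW2pos.isSymm_real.add hQsymm).sub (hQs t ht)
    intro t ht
    refine ⟨hSu t ht, posDef_of_continuousOn_of_isUnit hWc hWs hWu h2 hW2pos t ht, ?_⟩
    rw [Matrix.inv_eq_left_inv (hYW t ht)]
    have hST := Matrix.mul_nonsing_inv _ (hSu t ht)
    have hTS : ((S t)⁻¹)ᵀ * (S t)ᵀ = 1 := by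
      rw [← Matrix.transpose_mul, hST, Matrix.transpose_one]
    calc p t - P t = (S t * (S t)⁻¹) * (p t - P t) * (((S t)⁻¹)ᵀ * (S t)ᵀ) := by
          rw [hST, hTS, Matrix.one_mul, Matrix.mul_one]
      _ = _ := by simp only [Matrix.mul_assoc]
  · rintro t ⟨ht, hmem⟩
    simp only [mem_union, not_or] at hmem
    obtain ⟨⟨⟨hm1, hm2⟩, hm3⟩, hm4⟩ := hmem
    have htI := Ioo_subset_Icc_self ht
    have hST := Matrix.mul_nonsing_inv _ (hSu t htI)
    have hTS : ((S t)⁻¹)ᵀ * (S t)ᵀ = 1 := by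
      rw [← Matrix.transpose_mul, hST, Matrix.transpose_one]
    have dT : HasDerivAt (fun t => (S t)⁻¹) ((S t)⁻¹ * (A t + Sig t * P t)ᵀ) t := by
      convert (hdS t ⟨ht, hm3⟩).matrix_inv ((Matrix.isUnit_iff_isUnit_det _).2 (hSu t htI)) using 1
      rw [Matrix.mul_neg, Matrix.neg_mul, neg_neg, Matrix.mul_assoc, Matrix.mul_assoc, hST,
        Matrix.mul_one]
    have dD := (hdp t ⟨ht, hm1⟩).matrix_sub (hdP t ⟨ht, hm2⟩)
    have dW : HasDerivAt W ((S t)ᵀ * Sig t * S t) t := by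
      simpa using (HasDerivAt.matrix_const ((S t₂)ᵀ * (p t₂ - P t₂)⁻¹ * S t₂ + Q t₂)).matrix_sub (hdQ t ⟨ht, hm4⟩)
    convert (((dT.matrix_mul dD).matrix_mul dT.matrix_transpose).matrix_mul dW).matrix_sub
      (HasDerivAt.matrix_const 1) using 1
    simp only [riccatiRHS, Matrix.transpose_mul, Matrix.transpose_add, Matrix.transpose_transpose,
      (hSigsymm t htI).eq, (hPsymm t htI).eq]
    generalize W t = w
    generalize hT : (S t)⁻¹ = T at *
    -- Once `S S⁻¹ = 1` and its transpose are used in `e1` and `e2`, the remaining identity is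
    -- polynomial in the matrices.
    have e1 : S t * (T * (p t - P t) * Tᵀ * w - 1) = (p t - P t) * Tᵀ * w - S t := by
      rw [Matrix.mul_sub, Matrix.mul_one]
      simp only [← Matrix.mul_assoc]
      rw [hST, Matrix.one_mul]
    have e2 : T * (p t - P t) * Tᵀ * ((S t)ᵀ * Sig t * S t) = T * (p t - P t) * Sig t * S t := by
      calc _ = T * (p t - P t) * (Tᵀ * (S t)ᵀ) * Sig t * S t := by simp only [Matrix.mul_assoc]
        _ = _ := by rw [hTS, Matrix.mul_one]
    rw [e2, Matrix.mul_zero, add_zero, Matrix.neg_mul, Matrix.mul_assoc _ (S t), e1]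
    noncomm_ring
  · have hST := Matrix.mul_nonsing_inv _ hS
    have hTS : ((S t₂)⁻¹)ᵀ * (S t₂)ᵀ = 1 := by
      rw [← Matrix.transpose_mul, hST, Matrix.transpose_one]
    have : (S t₂)⁻¹ * (p t₂ - P t₂) * ((S t₂)⁻¹)ᵀ * W t₂ = 1 := by
      calc _ = (S t₂)⁻¹ * (p t₂ - P t₂) * (((S t₂)⁻¹)ᵀ * (S t₂)ᵀ) * (p t₂ - P t₂)⁻¹ * S t₂ := by
            simp only [hW, add_sub_cancel_right, Matrix.mul_assoc]
        _ = _ := by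
          rw [hTS, Matrix.mul_one, Matrix.mul_assoc (S t₂)⁻¹,
            Matrix.mul_nonsing_inv _ hD.isUnit_det, Matrix.mul_one, Matrix.nonsing_inv_mul _ hS]
    rw [this, sub_self]

end Riccati

/-! ### The dual quadratic as a semiconvex primal -/

theorem mainTheorem5 {n : ℕ} (t₁ t₂ : ℝ) (ht : t₁ < t₂)
    -- coefficients of the Riccati equation
    (A C Sig : ℝ → Matrix (Fin n) (Fin n) ℝ)
    (hA : IsPiecewiseCoeff t₁ t₂ A) (hC : IsPiecewiseCoeff t₁ t₂ C)
    (hSig : IsPiecewiseCoeff t₁ t₂ Sig)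
    (hCsymm : ∀ t ∈ Icc t₁ t₂, (C t).IsSymm) (hSigsymm : ∀ t ∈ Icc t₁ t₂, (Sig t).IsSymm)
    -- the primal quadratic `½ x'p_t x`
    (p : ℝ → Matrix (Fin n) (Fin n) ℝ)
    (hp : SolvesBackward t₁ t₂ (riccatiRHS A C Sig) p) (hpsymm : (p t₂).IsSymm)
    -- the bivariate quadratic `φ_t(x, z) = ½ x'P_t x + x'S_t z + ½ z'Q_t z`
    (P S Q : ℝ → Matrix (Fin n) (Fin n) ℝ)
    (hPSQ : SolvesBivariateRiccati t₁ t₂ A C Sig P S Q)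
    (hPsymm : (P t₂).IsSymm) (hQsymm : (Q t₂).IsSymm) (hS : IsUnit (S t₂).det)
    (hpP : (p t₂ - P t₂).PosSemidef)
    -- the semiconvex duals `½ z'q_t z` of the primal quadratics under the kernel `φ_{t₂}`
    (q : ℝ → Matrix (Fin n) (Fin n) ℝ) (hqsymm : ∀ t ∈ Icc t₁ t₂, (q t).IsSymm)
    (hq : ∀ t ∈ Icc t₁ t₂, ∀ z, dualAt P S Q p t₂ t z = ((quadFun (q t) z : ℝ) : EReal))
    -- `-dP/dt` is positive definite
    (hF : ∀ t ∈ Icc t₁ t₂, (riccatiRHS A C Sig t (P t)).PosDef) :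
    (P t₁ - P t₂).PosDef ∧
    dualAt P S Q p t₂ t₁ = semiconvexPrimal
      (dualKernel (kernelAt P S Q t₁) (kernelAt P S Q t₂)) (dualAt P S Q p t₂ t₂) ∧
    (∀ z y, dualKernel (kernelAt P S Q t₁) (kernelAt P S Q t₂) z y =
      ((biquadFun (dualB11 (P t₁) (P t₂) (S t₂) (Q t₂))
        (dualB12 (P t₁) (P t₂) (S t₁) (S t₂))
        (dualB22 (P t₁) (P t₂) (S t₁) (Q t₁)) z y : ℝ) : EReal)) ∧
    IsUnit (dualB22 (P t₁) (P t₂) (S t₁) (Q t₁) + q t₂).det ∧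
    q t₁ = dualB11 (P t₁) (P t₂) (S t₂) (Q t₂)
      - dualB12 (P t₁) (P t₂) (S t₁) (S t₂)
        * (dualB22 (P t₁) (P t₂) (S t₁) (Q t₁) + q t₂)⁻¹
        * (dualB12 (P t₁) (P t₂) (S t₁) (S t₂))ᵀ := by
  have h1 : t₁ ∈ Icc t₁ t₂ := ⟨le_rfl, ht.le⟩
  have h2 : t₂ ∈ Icc t₁ t₂ := ⟨ht.le, le_rfl⟩
  have hps := isSymm_of_riccati ht.le hA.entryBounded hSig.entryBounded hCsymm hSigsymm hp hpsymm
  have hPs := isSymm_of_riccati ht.le hA.entryBounded hSig.entryBounded hCsymm hSigsymm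
    hPSQ.eqP hPsymm
  have hE := sub_posDef_of_solvesBackward ht hPSQ.eqP hPs hF
  have hG : ∀ t ∈ Icc t₁ t₂, (p t - P t₂).PosDef := fun t ht =>
    posDef_of_semiconvexDual_finite ((hps t ht).sub hPsymm) hS (hq t ht)
  -- A symmetric matrix is determined by its quadratic form, so the explicit value of the infimum
  -- identifies `q t`.
  have hqG : ∀ t ∈ Icc t₁ t₂, q t = -((S t₂)ᵀ * (p t - P t₂)⁻¹ * S t₂) - Q t₂ := fun t ht => by
    have hGs : ((S t₂)ᵀ * (p t - P t₂)⁻¹ * S t₂).IsSymm :=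
      ((hG t ht).inv.transpose_mul_mul hS).isSymm_real
    refine eq_of_isSymm_of_quadForm_eq (hqsymm t ht) (hGs.neg.sub hQsymm) fun z => ?_
    have h := (hq t ht z).symm.trans (semiconvexDual_quad (hG t ht) z)
    rw [EReal.coe_eq_coe_iff, quadFun, quadFun] at h
    linarith
  obtain ⟨hS₁, hW, hD₁⟩ := riccati_sub_eq ht.le hA.entryBounded hSig.entryBounded hSigsymm hp
    hPSQ hPs hQsymm hS (hG t₂ h2) t₁ h1
  set W := (S t₂)ᵀ * (p t₂ - P t₂)⁻¹ * S t₂ + Q t₂ - Q t₁ with hWdef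
  have hsum : dualB22 (P t₁) (P t₂) (S t₁) (Q t₁) + q t₂ =
      -((S t₁)ᵀ * (P t₁ - P t₂)⁻¹ * S t₁ + W) := by
    rw [dualB22, hqG t₂ h2, hWdef]
    abel
  have hM : ((S t₁)ᵀ * (P t₁ - P t₂)⁻¹ * S t₁ + W).PosDef :=
    (hE.inv.transpose_mul_mul hS₁).add hW
  have hM' : (-(dualB22 (P t₁) (P t₂) (S t₁) (Q t₁) + q t₂)).PosDef := by rwa [hsum, neg_neg]
  have hq₁ : q t₁ = dualB11 (P t₁) (P t₂) (S t₂) (Q t₂)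
      - dualB12 (P t₁) (P t₂) (S t₁) (S t₂)
        * (dualB22 (P t₁) (P t₂) (S t₁) (Q t₁) + q t₂)⁻¹
        * (dualB12 (P t₁) (P t₂) (S t₁) (S t₂))ᵀ := by
    have hinv : (-((S t₁)ᵀ * (P t₁ - P t₂)⁻¹ * S t₁ + W))⁻¹ =
        -(W + (S t₁)ᵀ * (P t₁ - P t₂)⁻¹ * S t₁)⁻¹ := by
      refine Matrix.inv_eq_right_inv ?_
      rw [neg_mul_neg, add_comm, Matrix.mul_nonsing_inv]
      rw [add_comm]
      exact hM.isUnit_det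
    -- Woodbury for `E + S_{t₁}W⁻¹S_{t₁}'`, which is `(P_{t₁} - P_{t₂}) + (p_{t₁} - P_{t₁}) = p_{t₁}
    -- - P_{t₂}`, the matrix inverted in `q t₁`.
    have hwood := Matrix.add_mul_mul_inv_eq_sub (P t₁ - P t₂) (S t₁) W⁻¹ (S t₁)ᵀ
      ((Matrix.isUnit_iff_isUnit_det _).2 hE.isUnit_det)
      ((Matrix.isUnit_iff_isUnit_det _).2 hW.inv.isUnit_det)
      ((Matrix.isUnit_iff_isUnit_det _).2 (by
        rw [Matrix.nonsing_inv_nonsing_inv _ hW.isUnit_det, add_comm]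
        exact hM.isUnit_det))
    rw [Matrix.nonsing_inv_nonsing_inv _ hW.isUnit_det, ← hD₁, sub_add_sub_cancel'] at hwood
    rw [hqG t₁ h1, hsum, hinv, hwood]
    simp only [dualB11, dualB12, Matrix.transpose_mul, Matrix.transpose_transpose,
      hE.inv.isSymm_real.eq]
    noncomm_ring
  refine ⟨hE, ?_, fun z y => dualKernel_biquad hE z y, ?_, hq₁⟩
  · funext z
    have hval : dualAt P S Q p t₂ t₂ = fun y => ((quadFun (q t₂) y : ℝ) : EReal) :=
      funext (hq t₂ h2)
    have hker : dualKernel (kernelAt P S Q t₁) (kernelAt P S Q t₂) = fun z y =>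
        ((biquadFun (dualB11 (P t₁) (P t₂) (S t₂) (Q t₂))
          (dualB12 (P t₁) (P t₂) (S t₁) (S t₂))
          (dualB22 (P t₁) (P t₂) (S t₁) (Q t₁)) z y : ℝ) : EReal) :=
      funext fun z => funext fun y => dualKernel_biquad hE z y
    -- Both sides are now quadratic forms in `z`; the supremum over `y` is finite because `B₂₂ +
    -- q_{t₂}` is negative definite.
    rw [hq t₁ h1 z, hval, hker, hq₁]
    exact (iSup_biquad_add_quad hM' z).symm
  · exact (Matrix.isUnit_iff_isUnit_det _).1
      ((IsUnit.neg_iff _).1 ((Matrix.isUnit_iff_isUnit_det _).2 hM'.isUnit_det))
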